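/- For positive integers $k$ and $1\le j\le k+1$ and real $\zeta$, let $\lambda_{k,j}(\zeta)$ (respectively $\widehat{\lambda}_{k,j}(\zeta)$) be the supremum in $[-\infty,\infty]$ of all $\eta\in\mathbb{R}$ such that the system $$|x|\le X,\qquad \max_{1\le i\le k}|\zeta^{i}x-y_{i}|\le X^{-\eta}$$ has at least $j$ linearly independent solutions $(x,y_{1},\ldots,y_{k})\in\mathbb{Z}^{k+1}$ for arbitrarily large real $X$ (respectively for all sufficiently large real $X$). Corollary. The series $\sum_{l\ge 1}3^{-l!}$ converges, and the number $\zeta=2\sum_{l\geq 1}3^{-l!}$ is an element of the Cantor middle-third set. For every positive integer $k$, $$\lambda_{k,1}(\zeta)=\infty,\qquad \lambda_{k,j}(\zeta)=\frac{1}{j-1}\quad(2\le j\le k+1),$$ $$\widehat{\lambda}_{k,1}(\zeta)=\frac1k,\qquad \widehat{\lambda}_{k,j}(\zeta)=0\quad(2\le j\le k+1).$$ -/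

import Mathlib

open Filter
open scoped Nat

/-- The system `|x| ≤ X`, `max_{1 ≤ i ≤ k} |ζ_i x - y_i| ≤ X ^ (-η)` has (at least) `j` linearly
independent solutions in `ℤ^(k+1)`. An integer vector `(x, y_1, …, y_k)` is `v : Fin (k+1) → ℤ`
with `x = v 0` and `y_i = v i.succ`. -/
def HasIndepSolutions (k j : ℕ) (ζ : Fin k → ℝ) (η X : ℝ) : Prop :=
  ∃ v : Fin j → Fin (k + 1) → ℤ, LinearIndependent ℤ v ∧
    ∀ m : Fin j, |(v m 0 : ℝ)| ≤ X ∧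
      ∀ i : Fin k, |ζ i * (v m 0 : ℝ) - (v m i.succ : ℝ)| ≤ X ^ (-η)

/-- `λ_{k,j}(ζ_1, …, ζ_k)`: the supremum, in the extended reals, of the real `η` for which the
system has `j` linearly independent integer solutions for arbitrarily large real `X`. -/
noncomputable def approxConst (k j : ℕ) (ζ : Fin k → ℝ) : EReal :=
  sSup ((fun η : ℝ => (η : EReal)) '' {η : ℝ | ∃ᶠ X : ℝ in atTop, HasIndepSolutions k j ζ η X})

/-- The uniform constant `\hat λ_{k,j}(ζ_1, …, ζ_k)`: the supremum, in the extended reals, of the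
real `η` for which the system has `j` linearly independent integer solutions for all
sufficiently large real `X`. -/
noncomputable def unifApproxConst (k j : ℕ) (ζ : Fin k → ℝ) : EReal :=
  sSup ((fun η : ℝ => (η : EReal)) '' {η : ℝ | ∀ᶠ X : ℝ in atTop, HasIndepSolutions k j ζ η X})

/-- The vector `(ζ, ζ^2, …, ζ^k)`. -/
def powerVec (k : ℕ) (ζ : ℝ) : Fin k → ℝ := fun i => ζ ^ (i.val + 1)

/-- `λ_{k,j}(ζ) = λ_{k,j}(ζ, ζ^2, …, ζ^k)`. -/
noncomputable def powApproxConst (k j : ℕ) (ζ : ℝ) : EReal :=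
  approxConst k j (powerVec k ζ)

/-- `\hat λ_{k,j}(ζ) = \hat λ_{k,j}(ζ, ζ^2, …, ζ^k)`. -/
noncomputable def powUnifApproxConst (k j : ℕ) (ζ : ℝ) : EReal :=
  unifApproxConst k j (powerVec k ζ)

/-- The number `2 * ∑_{l ≥ 1} 3^(-l!)`; the summation index is `l + 1` with `l = 0, 1, 2, …`. -/
noncomputable def cantorLiouville : ℝ := 2 * ∑' l : ℕ, 1 / (3 : ℝ) ^ (l + 1)!

/-! Write `p / q` for the partial sum with `q = 3 ^ n!`, and `Q = q ^ (n + 1)` for the next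
denominator. Then `0 ≤ ζ - p / q ≤ 3 / Q`, and any fixed power of `q` is eventually negligible
against any positive power of `Q`.

Existence: expanding `(p / q + 2 / Q) ^ i` and truncating gives integer vectors with first
coordinates `Q ^ l * q ^ k` (`0 ≤ l ≤ d`), independent, with errors `O(q ^ k / Q)`
(`hasIndepSolutions_of_le`). At `X = Q ^ d * q ^ k` the error is `X ^ (-1/d + o(1))`. The case `d =
0` serves all `X` in `[q ^ k, Q ^ k)`, hence the uniform exponent `1 / k`.

Obstruction: an integer of absolute value below 1 is zero. If `X` is well below `Q`, this forces `q
* y_{i+1} = p * y_i`, so all solutions lie on one line and `q ^ k` divides `x`. If `X` is larger but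
below `Q ^ r` with `r < d`, the coefficient vectors of `(q * T - p) ^ s`, `d ≤ s ≤ k`, annihilate
all solutions, leaving rank at most `d` (`le_of_hasIndepSolutions`). -/

namespace CantorLiouville

/-! ### Partial sums and the tail of the series -/

/-- The denominator `3 ^ n!` of the `n`-th partial sum. -/
def den (n : ℕ) : ℕ := 3 ^ n !

/-- The numerator of the `n`-th partial sum over the denominator `3 ^ n!`. -/
def num (n : ℕ) : ℕ := ∑ l ∈ Finset.range n, 2 * 3 ^ ((n)! - (l + 1)!)

lemma den_pos (n : ℕ) : 0 < den n := by unfold den; positivity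

lemma den_succ (n : ℕ) : den (n + 1) = den n ^ (n + 1) := by
  rw [den, den, ← pow_mul, Nat.factorial_succ, mul_comm]

lemma cast_den_pos (n : ℕ) : (0 : ℝ) < den n := by exact_mod_cast den_pos n

lemma one_le_cast_den (n : ℕ) : (1 : ℝ) ≤ den n := by exact_mod_cast den_pos n

lemma tendsto_den : Tendsto den atTop atTop :=
  (tendsto_pow_atTop_atTop_of_one_lt (by norm_num : 1 < 3)).comp
    (tendsto_atTop_mono Nat.self_le_factorial tendsto_id)

lemma tendsto_cast_den : Tendsto (fun n => (den n : ℝ)) atTop atTop :=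
  tendsto_natCast_atTop_atTop.comp tendsto_den

lemma num_div_den (n : ℕ) :
    (num n : ℝ) / den n = 2 * ∑ l ∈ Finset.range n, 1 / (3 : ℝ) ^ (l + 1)! := by
  rw [num, den, Nat.cast_sum, Finset.sum_div, Finset.mul_sum]
  refine Finset.sum_congr rfl fun l hl => ?_
  have h : (l + 1)! ≤ n ! := Nat.factorial_le (Finset.mem_range.1 hl)
  push_cast
  rw [pow_sub₀ _ (by norm_num) h]
  field_simp

lemma num_div_den_succ (n : ℕ) :
    (num (n + 1) : ℝ) / den (n + 1) = num n / den n + 2 / den (n + 1) := by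
  rw [num_div_den, num_div_den, Finset.sum_range_succ, den]
  push_cast
  ring

/-- The last summand of the numerator is 2, and 3 divides all the others. -/
lemma coprime_num_den {n : ℕ} (hn : 1 ≤ n) : Nat.Coprime (num n) (den n) := by
  obtain ⟨n, rfl⟩ : ∃ m, n = m + 1 := ⟨n - 1, by omega⟩
  refine Nat.Coprime.pow_right _ ?_
  rw [Nat.coprime_comm, Nat.Prime.coprime_iff_not_dvd Nat.prime_three, num,
    Finset.sum_range_succ, Nat.sub_self, pow_zero, Nat.dvd_add_right]
  · norm_num
  · refine Finset.dvd_sum fun l hl => Dvd.dvd.mul_left (dvd_pow_self 3 ?_) 2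
    have h : (l + 1)! < (n + 1)! :=
      (Nat.factorial_lt (Nat.succ_pos l)).2 (Nat.succ_lt_succ (Finset.mem_range.1 hl))
    omega

lemma add_factorial_le (n l : ℕ) : (n + 1)! + l ≤ (l + n + 1)! := by
  have := Nat.add_factorial_succ_le_factorial_add_succ l n
  have h2 : l ≤ l ! := Nat.self_le_factorial l
  rw [← add_assoc] at this
  omega

lemma one_div_three_pow_le (n l : ℕ) :
    1 / (3 : ℝ) ^ (l + n + 1)! ≤ 1 / (den (n + 1) : ℝ) * (1 / 3) ^ l := by
  rw [den, one_div_pow, one_div_mul_one_div, Nat.cast_pow, Nat.cast_ofNat, ← pow_add]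
  exact one_div_le_one_div_of_le (by positivity)
    (pow_le_pow_right₀ (by norm_num) (add_factorial_le n l))

lemma summable_one_div_three_pow : Summable (fun l : ℕ => 1 / (3 : ℝ) ^ (l + 1)!) := by
  refine Summable.of_nonneg_of_le (fun l => by positivity) (one_div_three_pow_le 0)
    (Summable.mul_left _ (summable_geometric_of_lt_one (by norm_num) (by norm_num)))

lemma cantorLiouville_sub_eq (n : ℕ) :
    cantorLiouville - num n / den n = 2 * ∑' l : ℕ, 1 / (3 : ℝ) ^ (l + n + 1)! := by
  rw [num_div_den, cantorLiouville, ← summable_one_div_three_pow.sum_add_tsum_nat_add n]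
  ring

lemma num_div_den_le (n : ℕ) : (num n : ℝ) / den n ≤ cantorLiouville := by
  rw [← sub_nonneg, cantorLiouville_sub_eq]
  exact mul_nonneg zero_le_two (tsum_nonneg fun l => by positivity)

lemma cantorLiouville_sub_le (n : ℕ) :
    cantorLiouville - num n / den n ≤ 3 / den (n + 1) := by
  rw [cantorLiouville_sub_eq]
  have hg : Summable fun l : ℕ => ((1 : ℝ) / 3) ^ l :=
    summable_geometric_of_lt_one (by norm_num) (by norm_num)
  have hs : Summable fun l : ℕ => 1 / (3 : ℝ) ^ (l + n + 1)! :=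
    (summable_nat_add_iff (f := fun l : ℕ => 1 / (3 : ℝ) ^ (l + 1)!) n).2
      summable_one_div_three_pow
  have h := hs.tsum_le_tsum (one_div_three_pow_le n) (hg.mul_left _)
  rw [tsum_mul_left, tsum_geometric_of_lt_one (by norm_num) (by norm_num)] at h
  -- The geometric series of ratio `1 / 3` sums to `3 / 2`; the factor 2 of the series turns this
  -- into 3.
  refine (mul_le_mul_of_nonneg_left h zero_le_two).trans_eq ?_
  generalize (den (n + 1) : ℝ) = D
  ring

lemma cantorLiouville_nonneg : 0 ≤ cantorLiouville :=
  le_trans (by positivity) (num_div_den_le 0)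

/-! ### Membership in the Cantor set -/

lemma cantorLiouville_mem_cantorSet : cantorLiouville ∈ cantorSet := by
  classical
  have hinj : Function.Injective fun l : ℕ => (l + 1)! - 1 := by
    refine StrictMono.injective (strictMono_nat_of_lt_succ fun l => ?_)
    have h := (Nat.factorial_lt (Nat.succ_pos l)).2 (Nat.lt_succ_self (l + 1))
    have := Nat.factorial_pos (l + 1)
    simp only [Nat.succ_eq_add_one] at h
    omega
  -- The digit with index `i` has weight `3 ^ (-(i + 1))`, hence the shift by one in the positions.
  let a : ℕ → Fin 3 := fun i => if i ∈ Set.range (fun l : ℕ => (l + 1)! - 1) then 2 else 0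
  have ha : cantorLiouville = Real.ofDigits a := by
    rw [cantorLiouville, Real.ofDigits, ← tsum_mul_left, ← hinj.tsum_eq (f := Real.ofDigitsTerm a)]
    · refine tsum_congr fun l => ?_
      have : (l + 1)! - 1 + 1 = (l + 1)! := Nat.sub_add_cancel (Nat.factorial_pos _)
      simp [a, Real.ofDigitsTerm, this]
    · intro i hi
      by_contra h
      exact hi (by simp only [Real.ofDigitsTerm, a, if_neg h]; simp)
  rw [ha]
  refine ofDigits_zero_two_sequence_mem_cantorSet fun n => ?_
  simp only [a]
  split_ifs <;> decide

lemma cantorLiouville_le_one : cantorLiouville ≤ 1 :=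
  (cantorSet_subset_unitInterval cantorLiouville_mem_cantorSet).2

lemma num_le_den (n : ℕ) : num n ≤ den n := by
  have h := (num_div_den_le n).trans cantorLiouville_le_one
  rw [div_le_one (cast_den_pos n)] at h
  exact_mod_cast h

/-! ### Growth of the denominators -/

lemma eventually_mul_den_rpow_lt_den_rpow (C : ℝ) {a b : ℝ} (hab : a < b) :
    ∀ᶠ n in atTop, C * (den n : ℝ) ^ a < (den n : ℝ) ^ b := by
  filter_upwards [((tendsto_rpow_atTop (sub_pos.2 hab)).comp
    tendsto_cast_den).eventually_gt_atTop C] with n hn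
  have h := Real.rpow_pos_of_pos (cast_den_pos n) a
  calc _ < _ := mul_lt_mul_of_pos_right hn h
    _ = _ := by rw [Function.comp_apply, ← Real.rpow_add (cast_den_pos n), sub_add_cancel]

lemma eventually_mul_den_rpow_lt_den_succ_rpow (C a : ℝ) {b : ℝ} (hb : 0 < b) :
    ∀ᶠ n in atTop, C * (den n : ℝ) ^ a < (den (n + 1) : ℝ) ^ b := by
  filter_upwards [eventually_mul_den_rpow_lt_den_rpow C (lt_add_one a),
    (tendsto_natCast_atTop_atTop (R := ℝ)).eventually_ge_atTop ((a + 1) / b)] with n h1 h2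
  refine h1.trans_le ?_
  rw [div_le_iff₀ hb] at h2
  rw [den_succ, Nat.cast_pow, ← Real.rpow_natCast, ← Real.rpow_mul (cast_den_pos n).le]
  refine Real.rpow_le_rpow_of_exponent_le (one_le_cast_den n) ?_
  push_cast
  linarith

/-! ### Bounding the number of independent solutions -/

/-- Projection to the first `d` coordinates is injective on `S`, so it keeps the family independent.
-/
lemma le_of_linearIndependent_of_forall_eq_zero {N j d : ℕ} {v : Fin j → Fin N → ℤ}
    (hv : LinearIndependent ℤ v) (S : Submodule ℤ (Fin N → ℤ)) (hvS : ∀ m, v m ∈ S)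
    (hS : ∀ w ∈ S, (∀ i : Fin N, i.val < d → w i = 0) → w = 0) : j ≤ d := by
  let L : (Fin N → ℤ) →ₗ[ℤ] ({i : Fin N // i.val < d} → ℤ) :=
    LinearMap.funLeft ℤ ℤ Subtype.val
  have hspan : Submodule.span ℤ (Set.range v) ≤ S :=
    Submodule.span_le.2 (Set.range_subset_iff.2 hvS)
  have hdisj : Disjoint (Submodule.span ℤ (Set.range v)) (LinearMap.ker L) := by
    refine Submodule.disjoint_def.2 fun w hw hwL => hS w (hspan hw) fun i hi => ?_
    exact congrFun (LinearMap.mem_ker.1 hwL) ⟨i, hi⟩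
  have h1 := (hv.map hdisj).fintype_card_le_finrank
  rw [Fintype.card_fin, Module.finrank_fintype_fun_eq_card] at h1
  have h2 : Fintype.card {i : Fin N // i.val < d} ≤ Fintype.card (Fin d) :=
    Fintype.card_le_of_injective (fun i => ⟨i.1.1, i.2⟩) fun a b hab => by
      simpa [Subtype.ext_iff, Fin.ext_iff] using hab
  rw [Fintype.card_fin] at h2
  exact h1.trans h2

lemma add_pow_eq_sum_range_of_le {R : Type*} [CommSemiring R] (x y : R) {r k : ℕ} (h : r ≤ k) :
    (x + y) ^ r = ∑ i ∈ Finset.range (k + 1), x ^ i * y ^ (r - i) * r.choose i := by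
  rw [add_pow]
  refine Finset.sum_subset (Finset.range_subset_range.2 (by omega)) fun i _ hi => ?_
  rw [Nat.choose_eq_zero_of_lt (by simpa using hi), Nat.cast_zero, mul_zero]

lemma abs_den_mul_sub_num_le (n : ℕ) :
    |(den n : ℝ) * cantorLiouville - num n| ≤ 3 * den n / den (n + 1) := by
  have h1 := num_div_den_le n
  have h2 := cantorLiouville_sub_le n
  have hq := cast_den_pos n
  have h : (den n : ℝ) * cantorLiouville - num n = den n * (cantorLiouville - num n / den n) := by
    field_simp
  rw [h, abs_of_nonneg (mul_nonneg hq.le (sub_nonneg.2 h1))]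
  exact (mul_le_mul_of_nonneg_left h2 hq.le).trans_eq (by ring)

lemma abs_pow_cantorLiouville_le_one (i : ℕ) : |cantorLiouville ^ i| ≤ 1 := by
  rw [abs_pow, abs_of_nonneg cantorLiouville_nonneg]
  exact pow_le_one₀ cantorLiouville_nonneg cantorLiouville_le_one

lemma abs_pow_mul_sub_le {k : ℕ} {v : Fin (k + 1) → ℤ} {ε : ℝ} (hε : 0 ≤ ε)
    (hv : ∀ i : Fin k, |powerVec k cantorLiouville i * (v 0 : ℝ) - (v i.succ : ℝ)| ≤ ε)
    (i : Fin (k + 1)) : |cantorLiouville ^ i.val * (v 0 : ℝ) - v i| ≤ ε := by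
  refine Fin.cases ?_ (fun i => ?_) i
  · simpa using hε
  · simpa [powerVec] using hv i

/-- The difference of the two sides is an integer. Replacing each `v i` by `ζ ^ i * v 0` costs at
most `2 * q * ε`, and what remains is `v 0 * ζ ^ i * (q * ζ - p)`; together they stay below 1. -/
lemma den_mul_succ_eq {k n : ℕ} {v : Fin (k + 1) → ℤ} {X ε : ℝ} (hX : |(v 0 : ℝ)| ≤ X)
    (hv : ∀ i : Fin (k + 1), |cantorLiouville ^ i.val * (v 0 : ℝ) - v i| ≤ ε)
    (h : 2 * den n * ε + X * (3 * den n / den (n + 1)) < 1) (i : Fin k) :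
    (den n : ℤ) * v i.succ = num n * v i.castSucc := by
  have h1 := hv i.succ
  have h2 := hv i.castSucc
  rw [Fin.val_succ] at h1
  rw [Fin.val_castSucc] at h2
  have hq := cast_den_pos n
  have hp : (0 : ℝ) ≤ num n := Nat.cast_nonneg _
  have hpq : (num n : ℝ) ≤ den n := by exact_mod_cast num_le_den n
  have hε : 0 ≤ ε := (abs_nonneg _).trans h2
  have e1 : |(den n : ℝ) * (cantorLiouville ^ (i.val + 1) * v 0 - v i.succ)| ≤ den n * ε := by
    rw [abs_mul, abs_of_pos hq]
    exact mul_le_mul_of_nonneg_left h1 hq.le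
  have e2 : |(num n : ℝ) * (cantorLiouville ^ i.val * v 0 - v i.castSucc)| ≤ den n * ε := by
    rw [abs_mul, abs_of_nonneg hp]
    exact mul_le_mul hpq h2 (abs_nonneg _) hq.le
  have e3 : |(v 0 : ℝ) * (cantorLiouville ^ i.val * (den n * cantorLiouville - num n))| ≤
      X * (3 * den n / den (n + 1)) := by
    rw [abs_mul, abs_mul]
    refine mul_le_mul hX ?_ (by positivity) ((abs_nonneg _).trans hX)
    exact (mul_le_of_le_one_left (abs_nonneg _) (abs_pow_cantorLiouville_le_one _)).trans
      (abs_den_mul_sub_num_le n)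
  have key : |(((den n : ℤ) * v i.succ - num n * v i.castSucc : ℤ) : ℝ)| < 1 := by
    have e : (((den n : ℤ) * v i.succ - num n * v i.castSucc : ℤ) : ℝ) =
        -((den n : ℝ) * (cantorLiouville ^ (i.val + 1) * v 0 - v i.succ)) +
        (num n : ℝ) * (cantorLiouville ^ i.val * v 0 - v i.castSucc) +
        (v 0 : ℝ) * (cantorLiouville ^ i.val * (den n * cantorLiouville - num n)) := by
      push_cast
      ring
    rw [e]
    refine (abs_add_three _ _ _).trans_lt ?_
    rw [abs_neg]
    linarith
  rw [← Int.cast_abs, ← Int.cast_one, Int.cast_lt, Int.abs_lt_one_iff] at key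
  exact sub_eq_zero.1 key

lemma den_pow_mul_eq {k n : ℕ} {v : Fin (k + 1) → ℤ}
    (h : ∀ i : Fin k, (den n : ℤ) * v i.succ = num n * v i.castSucc) (i : Fin (k + 1)) :
    (den n : ℤ) ^ i.val * v i = num n ^ i.val * v 0 := by
  induction i using Fin.induction with
  | zero => simp
  | succ i ih =>
    rw [Fin.val_castSucc] at ih
    rw [Fin.val_succ, pow_succ, pow_succ, mul_assoc, h i, mul_left_comm, ih]
    ring

lemma eq_zero_of_den_mul_succ_eq {k n : ℕ} {v : Fin (k + 1) → ℤ}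
    (h : ∀ i : Fin k, (den n : ℤ) * v i.succ = num n * v i.castSucc) (h0 : v 0 = 0) : v = 0 := by
  funext i
  have hi := den_pow_mul_eq h i
  rw [h0, mul_zero] at hi
  have hq : (den n : ℤ) ^ i.val ≠ 0 := pow_ne_zero _ (by exact_mod_cast (den_pos n).ne')
  exact (mul_eq_zero.1 hi).resolve_left hq

/-- Integer vectors proportional to `(q ^ k, p * q ^ (k - 1), …, p ^ k)` with `p = num n` and
`q = den n`. -/
def lineSubmodule (k n : ℕ) : Submodule ℤ (Fin (k + 1) → ℤ) where
  carrier := {v | ∀ i : Fin k, (den n : ℤ) * v i.succ = num n * v i.castSucc}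
  add_mem' ha hb i := by
    rw [Pi.add_apply, Pi.add_apply, mul_add, mul_add, ha i, hb i]
  zero_mem' i := by simp
  smul_mem' c v hv i := by
    rw [Pi.smul_apply, Pi.smul_apply, smul_eq_mul, smul_eq_mul, mul_left_comm, hv i,
      mul_left_comm]

lemma le_one_of_hasIndepSolutions {k j n : ℕ} {η X : ℝ} (hX : 0 ≤ X)
    (h : 2 * den n * X ^ (-η) + X * (3 * den n / den (n + 1)) < 1)
    (hj : HasIndepSolutions k j (powerVec k cantorLiouville) η X) : j ≤ 1 := by
  obtain ⟨v, hv, hvX⟩ := hj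
  refine le_of_linearIndependent_of_forall_eq_zero hv (lineSubmodule k n)
    (fun m => den_mul_succ_eq (hvX m).1
      (abs_pow_mul_sub_le (Real.rpow_nonneg hX _) (hvX m).2) h) fun w hw h0 => ?_
  exact eq_zero_of_den_mul_succ_eq hw (h0 0 (by simp))

/-- On the line `q ^ k * v k = p ^ k * v 0`, and coprimality gives `q ^ k ∣ v 0`, which is too large
unless `v 0 = 0`. -/
lemma not_hasIndepSolutions_one {k n : ℕ} {η X : ℝ} (hn : 1 ≤ n) (hX : 0 ≤ X)
    (hXn : X < den n ^ k) (h : 2 * den n * X ^ (-η) + X * (3 * den n / den (n + 1)) < 1) :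
    ¬ HasIndepSolutions k 1 (powerVec k cantorLiouville) η X := by
  rintro ⟨v, hv, hvX⟩
  have hline := den_mul_succ_eq (hvX 0).1
    (abs_pow_mul_sub_le (Real.rpow_nonneg hX _) (hvX 0).2) h
  refine hv.ne_zero 0 (eq_zero_of_den_mul_succ_eq hline ?_)
  have hlast := den_pow_mul_eq hline (Fin.last k)
  have hcop : IsCoprime ((den n : ℤ) ^ k) ((num n : ℤ) ^ k) :=
    (Nat.isCoprime_iff_coprime.2 (coprime_num_den hn).symm).pow
  rw [Fin.val_last] at hlast
  have hdvd : (den n : ℤ) ^ k ∣ v 0 0 := hcop.dvd_of_dvd_mul_left ⟨_, hlast.symm⟩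
  refine Int.eq_zero_of_abs_lt_dvd hdvd ?_
  exact_mod_cast (hvX 0).1.trans_lt hXn

/-- The coefficient of `T ^ i` in `(q * T - p) ^ r`, with `p = num n` and `q = den n`. -/
def coeff (n r i : ℕ) : ℤ := (den n : ℤ) ^ i * (-(num n : ℤ)) ^ (r - i) * r.choose i

lemma sum_coeff_mul_pow (n : ℕ) {r k : ℕ} (h : r ≤ k) (x : ℝ) :
    ∑ i : Fin (k + 1), (coeff n r i : ℝ) * x ^ i.val = (den n * x - num n) ^ r := by
  rw [sub_eq_add_neg, add_pow_eq_sum_range_of_le _ _ h,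
    Fin.sum_univ_eq_sum_range (fun i => (coeff n r i : ℝ) * x ^ i)]
  refine Finset.sum_congr rfl fun i _ => ?_
  rw [coeff]
  push_cast
  ring

lemma sum_abs_coeff_le (n : ℕ) {r k : ℕ} (h : r ≤ k) :
    ∑ i : Fin (k + 1), |(coeff n r i : ℝ)| ≤ (2 * den n) ^ k := by
  have e : ∑ i : Fin (k + 1), |(coeff n r i : ℝ)| = ((den n : ℝ) + num n) ^ r := by
    rw [add_pow_eq_sum_range_of_le _ _ h,
      Fin.sum_univ_eq_sum_range (fun i => |(coeff n r i : ℝ)|)]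
    refine Finset.sum_congr rfl fun i _ => ?_
    rw [coeff]
    push_cast
    rw [abs_mul, abs_mul, abs_pow, abs_pow, abs_neg]
    simp
  have hpq : (num n : ℝ) ≤ den n := by exact_mod_cast num_le_den n
  have hq := one_le_cast_den n
  rw [e]
  calc ((den n : ℝ) + num n) ^ r ≤ (2 * den n) ^ r :=
        pow_le_pow_left₀ (by positivity) (by linarith) r
    _ ≤ _ := pow_le_pow_right₀ (by linarith) h

/-- Substituting `ζ ^ i * v 0` for `v i` turns this integer into `v 0 * (q * ζ - p) ^ r`, which is
small because of the `r`-th power. -/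
lemma sum_coeff_mul_eq_zero {k n r : ℕ} {v : Fin (k + 1) → ℤ} {X ε : ℝ} (hr : r ≤ k)
    (hX : |(v 0 : ℝ)| ≤ X)
    (hv : ∀ i : Fin (k + 1), |cantorLiouville ^ i.val * (v 0 : ℝ) - v i| ≤ ε)
    (h : (2 * den n) ^ k * ε + X * (3 * den n / den (n + 1)) ^ r < 1) :
    ∑ i : Fin (k + 1), coeff n r i * v i = 0 := by
  have hε : 0 ≤ ε := (abs_nonneg _).trans (hv 0)
  have e : ((∑ i : Fin (k + 1), coeff n r i * v i : ℤ) : ℝ) =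
      v 0 * (den n * cantorLiouville - num n) ^ r -
        ∑ i : Fin (k + 1), coeff n r i * (cantorLiouville ^ i.val * v 0 - v i) := by
    rw [← sum_coeff_mul_pow n hr, Finset.mul_sum, ← Finset.sum_sub_distrib, Int.cast_sum]
    refine Finset.sum_congr rfl fun i _ => ?_
    push_cast
    ring
  have e1 : |(v 0 : ℝ) * (den n * cantorLiouville - num n) ^ r| ≤
      X * (3 * den n / den (n + 1)) ^ r := by
    rw [abs_mul, abs_pow]
    exact mul_le_mul hX (pow_le_pow_left₀ (abs_nonneg _) (abs_den_mul_sub_num_le n) r)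
      (by positivity) ((abs_nonneg _).trans hX)
  have e2 : |∑ i : Fin (k + 1), (coeff n r i : ℝ) * (cantorLiouville ^ i.val * v 0 - v i)| ≤
      (2 * den n) ^ k * ε := by
    refine (Finset.abs_sum_le_sum_abs _ _).trans ?_
    refine le_trans ?_ (mul_le_mul_of_nonneg_right (sum_abs_coeff_le n hr) hε)
    rw [Finset.sum_mul]
    refine Finset.sum_le_sum fun i _ => ?_
    rw [abs_mul]
    exact mul_le_mul_of_nonneg_left (hv i) (abs_nonneg _)
  rw [← Int.abs_lt_one_iff, ← Int.cast_lt (R := ℝ), Int.cast_abs, Int.cast_one, e]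
  refine (abs_sub _ _).trans_lt ?_
  linarith

/-- Integer vectors annihilated by the coefficients of `(q * T - p) ^ r` for `d ≤ r ≤ k`, with
`p = num n` and `q = den n`. -/
def powSubmodule (k n d : ℕ) : Submodule ℤ (Fin (k + 1) → ℤ) where
  carrier := {v | ∀ r, d ≤ r → r ≤ k → ∑ i : Fin (k + 1), coeff n r i * v i = 0}
  add_mem' ha hb r hr hk := by
    simp only [Pi.add_apply, mul_add, Finset.sum_add_distrib, ha r hr hk, hb r hr hk, add_zero]
  zero_mem' r _ _ := by simp
  smul_mem' c v hv r hr hk := by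
    simp only [Pi.smul_apply, smul_eq_mul, mul_left_comm _ c, ← Finset.mul_sum, hv r hr hk,
      mul_zero]

/-- The equations are triangular: `(q * T - p) ^ r` has degree `r` and leading coefficient `q ^ r ≠
0`, so each `w r` with `r ≥ d` is determined by the earlier coordinates. -/
lemma eq_zero_of_mem_powSubmodule {k n d : ℕ} {w : Fin (k + 1) → ℤ}
    (hw : w ∈ powSubmodule k n d) (h0 : ∀ i : Fin (k + 1), i.val < d → w i = 0) : w = 0 := by
  have h : ∀ r (hr : r < k + 1), w ⟨r, hr⟩ = 0 := by
    intro r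
    induction r using Nat.strong_induction_on with
    | _ r ih =>
      intro hr
      by_cases hd : r < d
      · exact h0 _ hd
      · have hs := hw r (by omega) (by omega)
        rw [Finset.sum_eq_single ⟨r, hr⟩] at hs
        · refine (mul_eq_zero.1 hs).resolve_left ?_
          simp [coeff, (den_pos n).ne']
        · intro i _ hi
          rcases lt_or_gt_of_ne (fun h => hi (Fin.ext h) : i.val ≠ r) with hlt | hgt
          · rw [ih i hlt i.isLt, mul_zero]
          · simp [coeff, Nat.choose_eq_zero_of_lt hgt]
        · simp
  funext i
  exact h i i.isLt

lemma le_of_hasIndepSolutions {k j n d : ℕ} {η X : ℝ} (hX : 0 ≤ X)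
    (h : ∀ r, d ≤ r → r ≤ k →
      (2 * den n) ^ k * X ^ (-η) + X * (3 * den n / den (n + 1)) ^ r < 1)
    (hj : HasIndepSolutions k j (powerVec k cantorLiouville) η X) : j ≤ d := by
  obtain ⟨v, hv, hvX⟩ := hj
  exact le_of_linearIndependent_of_forall_eq_zero hv (powSubmodule k n d)
    (fun m r hr hk => sum_coeff_mul_eq_zero hk (hvX m).1
      (abs_pow_mul_sub_le (Real.rpow_nonneg hX _) (hvX m).2) (h r hr hk))
    fun w hw h0 => eq_zero_of_mem_powSubmodule hw h0

/-! ### Construction of independent approximations -/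

/-- For `l ≤ d`, the integer part of `q ^ k * Q ^ l * (p / q + 2 / Q) ^ i`, expanded by the
binomial formula and cut off after the term with index `l`; here `p = num n`, `q = den n` and
`Q = den (n + 1)`. -/
def approxVec (k n l i : ℕ) : ℤ :=
  ∑ s ∈ Finset.range (l + 1),
    (den (n + 1) : ℤ) ^ (l - s) *
      (2 ^ s * i.choose s * num n ^ (i - s) * den n ^ (k - (i - s)))

lemma approxVec_zero (k n l : ℕ) : approxVec k n l 0 = den (n + 1) ^ l * den n ^ k := by
  rw [approxVec, Finset.sum_range_succ', Finset.sum_eq_zero]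
  · simp
  · intro s _
    simp

lemma approxVec_eq_sum (k n i : ℕ) {d : ℕ} (l : Fin (d + 1)) :
    approxVec k n l i = ∑ s : Fin (d + 1),
      (if s ≤ l then (den (n + 1) : ℤ) ^ (l.val - s.val) else 0) *
        (2 ^ s.val * i.choose s * num n ^ (i - s) * den n ^ (k - (i - s))) := by
  simp only [ite_mul, zero_mul, Fin.le_def]
  rw [Fin.sum_univ_eq_sum_range (fun s => if s ≤ l.val then (den (n + 1) : ℤ) ^ (l.val - s) *
      (2 ^ s * i.choose s * num n ^ (i - s) * den n ^ (k - (i - s))) else 0),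
    ← Finset.sum_filter, approxVec]
  congr 1
  ext s
  have := l.isLt
  simp only [Finset.mem_range, Finset.mem_filter]
  omega

/-- The first `d + 1` columns factor as lower triangular (unit diagonal) times upper triangular
(diagonal `2 ^ s * q ^ k`). -/
lemma linearIndependent_approxVec {k n d : ℕ} (hd : d ≤ k) :
    LinearIndependent ℤ fun (l : Fin (d + 1)) (i : Fin (k + 1)) => approxVec k n l i := by
  let A : Matrix (Fin (d + 1)) (Fin (d + 1)) ℤ :=
    Matrix.of fun l s => if s ≤ l then (den (n + 1) : ℤ) ^ (l.val - s.val) else 0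
  let B : Matrix (Fin (d + 1)) (Fin (d + 1)) ℤ := Matrix.of fun s i =>
    2 ^ s.val * (i.val.choose s) * num n ^ (i.val - s) * den n ^ (k - (i.val - s))
  have hA : A.det ≠ 0 := by
    rw [Matrix.det_of_isLowerTriangular]
    · simp [A]
    · intro i j hij
      have : ¬ j ≤ i := not_le.2 hij
      simp [A, this]
  have hB : B.det ≠ 0 := by
    rw [Matrix.det_of_isUpperTriangular]
    · simp [B, Finset.prod_ne_zero_iff, (den_pos n).ne']
    · intro i j hij
      have : j.val < i.val := hij
      simp [B, Nat.choose_eq_zero_of_lt this]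
  have hAB : (A * B).det ≠ 0 := by
    rw [Matrix.det_mul]
    exact mul_ne_zero hA hB
  let L : (Fin (k + 1) → ℤ) →ₗ[ℤ] (Fin (d + 1) → ℤ) :=
    LinearMap.funLeft ℤ ℤ (Fin.castLE (by omega))
  refine LinearIndependent.of_comp L ?_
  have e : (L ∘ fun (l : Fin (d + 1)) (i : Fin (k + 1)) => approxVec k n l i) = (A * B).row := by
    funext l i
    exact approxVec_eq_sum k n i l
  rw [e]
  exact Matrix.linearIndependent_rows_of_det_ne_zero hAB

/-- Passing from `ζ` to the next partial sum contributes `3 * k`, since `l ≤ n` leaves a spare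
factor `Q`. The dropped binomial terms `s > l` each carry a factor `1 / Q` and contribute at most
`(1 + 2) ^ i ≤ 3 ^ k`. -/
lemma abs_pow_mul_sub_approxVec_le {k n l i : ℕ} (hk : k ≤ n) (hl : l ≤ k) (hi : i ≤ k) :
    |cantorLiouville ^ i * ((den (n + 1) : ℝ) ^ l * den n ^ k) - approxVec k n l i| ≤
      (3 ^ k + 3 * k) * ((den n : ℝ) ^ k / den (n + 1)) := by
  have hq := cast_den_pos n
  have hQ := cast_den_pos (n + 1)
  have hQ1 := one_le_cast_den (n + 1)
  set q : ℝ := (den n : ℝ) with hqdef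
  set Q : ℝ := (den (n + 1) : ℝ) with hQdef
  set p : ℝ := (num n : ℝ) with hpdef
  have hp : (0 : ℝ) ≤ p := Nat.cast_nonneg _
  have hpq : p / q ≤ 1 := (div_le_one hq).2 (Nat.cast_le.2 (num_le_den n))
  set x : ℝ := p / q + 2 / Q with hx
  have hx0 : 0 ≤ x := by positivity
  have hxζ : x ≤ cantorLiouville := by
    rw [hx, ← num_div_den_succ]
    exact num_div_den_le (n + 1)
  have hdist : |cantorLiouville - x| ≤ 3 / Q ^ (n + 2) := by
    rw [abs_of_nonneg (sub_nonneg.2 hxζ), hx, ← num_div_den_succ]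
    refine (cantorLiouville_sub_le (n + 1)).trans_eq ?_
    rw [den_succ (n + 1), Nat.cast_pow]
  have h1 : |cantorLiouville ^ i - x ^ i| ≤ 3 / Q ^ (n + 2) * k := by
    refine (abs_pow_sub_pow_le _ _ _).trans ?_
    have hm : max |cantorLiouville| |x| ^ (i - 1) ≤ 1 := by
      refine pow_le_one₀ (by positivity) (max_le ?_ ?_)
      · rw [abs_of_nonneg cantorLiouville_nonneg]
        exact cantorLiouville_le_one
      · rw [abs_of_nonneg hx0]
        exact hxζ.trans cantorLiouville_le_one
    have hik : (i : ℝ) ≤ k := by exact_mod_cast hi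
    exact (mul_le_of_le_one_right (by positivity) hm).trans
      (mul_le_mul hdist hik (by positivity) (by positivity))
  have h2 : |(cantorLiouville ^ i - x ^ i) * (Q ^ l * q ^ k)| ≤ 3 * k * (q ^ k / Q) := by
    rw [abs_mul, abs_of_pos (by positivity : 0 < Q ^ l * q ^ k)]
    refine (mul_le_mul_of_nonneg_right h1 (by positivity)).trans ?_
    have hQl : Q ^ l * Q ≤ Q ^ (n + 2) := by
      rw [← pow_succ]
      exact pow_le_pow_right₀ hQ1 (by omega)
    calc 3 / Q ^ (n + 2) * k * (Q ^ l * q ^ k)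
        = 3 * k * (q ^ k / Q) * (Q ^ l * Q / Q ^ (n + 2)) := by field_simp
      _ ≤ _ := mul_le_of_le_one_right (by positivity) ((div_le_one (by positivity)).2 hQl)
  let t : ℕ → ℝ := fun s => (2 / Q) ^ s * (p / q) ^ (i - s) * i.choose s * (Q ^ l * q ^ k)
  have h3 : x ^ i * (Q ^ l * q ^ k) = ∑ s ∈ Finset.range (k + 1), t s := by
    rw [hx, add_comm, add_pow_eq_sum_range_of_le _ _ hi, Finset.sum_mul]
  have h4 : (approxVec k n l i : ℝ) = ∑ s ∈ Finset.range (l + 1), t s := by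
    rw [approxVec, Int.cast_sum]
    refine Finset.sum_congr rfl fun s hs => ?_
    have hs' : s ≤ l := Nat.lt_succ_iff.1 (Finset.mem_range.1 hs)
    push_cast
    simp only [t, ← hqdef, ← hQdef, ← hpdef]
    rw [pow_sub₀ _ hQ.ne' hs', pow_sub₀ _ hq.ne' (by omega : i - s ≤ k), div_pow, div_pow]
    field_simp
  have h5 : x ^ i * (Q ^ l * q ^ k) - approxVec k n l i =
      ∑ s ∈ Finset.Ico (l + 1) (k + 1), t s := by
    rw [h3, h4, Finset.sum_Ico_eq_sub _ (by omega)]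
  have h6 : |x ^ i * (Q ^ l * q ^ k) - approxVec k n l i| ≤ 3 ^ k * (q ^ k / Q) := by
    rw [h5, abs_of_nonneg (Finset.sum_nonneg fun s _ => by positivity)]
    have h7 : ∀ s ∈ Finset.Ico (l + 1) (k + 1),
        t s ≤ 2 ^ s * 1 ^ (i - s) * i.choose s * (q ^ k / Q) := by
      intro s hs
      have hs' : l + 1 ≤ s := (Finset.mem_Ico.1 hs).1
      have hQs : Q ^ l * Q ≤ Q ^ s := by
        rw [← pow_succ]
        exact pow_le_pow_right₀ hQ1 hs'
      have hpow : (p / q) ^ (i - s) ≤ 1 ^ (i - s) := pow_le_pow_left₀ (by positivity) hpq _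
      calc t s = 2 ^ s * (p / q) ^ (i - s) * i.choose s * (q ^ k / Q) * (Q ^ l * Q / Q ^ s) := by
            simp only [t, div_pow (2 : ℝ)]
            field_simp
        _ ≤ 2 ^ s * (p / q) ^ (i - s) * i.choose s * (q ^ k / Q) :=
            mul_le_of_le_one_right (by positivity) ((div_le_one (by positivity)).2 hQs)
        _ ≤ _ := by gcongr
    refine (Finset.sum_le_sum h7).trans ?_
    rw [← Finset.sum_mul]
    refine mul_le_mul_of_nonneg_right ?_ (by positivity)
    calc ∑ s ∈ Finset.Ico (l + 1) (k + 1), (2 : ℝ) ^ s * 1 ^ (i - s) * i.choose s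
        ≤ ∑ s ∈ Finset.range (k + 1), (2 : ℝ) ^ s * 1 ^ (i - s) * i.choose s := by
          refine Finset.sum_le_sum_of_subset_of_nonneg (fun s hs => ?_) fun s _ _ => by positivity
          exact Finset.mem_range.2 (Finset.mem_Ico.1 hs).2
      _ = 3 ^ i := by rw [← add_pow_eq_sum_range_of_le _ _ hi]; norm_num
      _ ≤ 3 ^ k := pow_le_pow_right₀ (by norm_num) hi
  calc _ = |(cantorLiouville ^ i - x ^ i) * (Q ^ l * q ^ k) +
        (x ^ i * (Q ^ l * q ^ k) - approxVec k n l i)| := by congr 1; ring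
    _ ≤ _ := abs_add_le _ _
    _ ≤ _ := by linarith

lemma hasIndepSolutions_of_le {k n d : ℕ} {η X : ℝ} (hd : d ≤ k) (hk : k ≤ n)
    (hX : (den (n + 1) : ℝ) ^ d * den n ^ k ≤ X)
    (hη : (3 ^ k + 3 * k) * ((den n : ℝ) ^ k / den (n + 1)) ≤ X ^ (-η)) :
    HasIndepSolutions k (d + 1) (powerVec k cantorLiouville) η X := by
  refine ⟨_, linearIndependent_approxVec (n := n) hd, fun l => ?_⟩
  have hl : l.val ≤ d := Nat.lt_succ_iff.1 l.isLt
  have e : ((approxVec k n l (0 : Fin (k + 1)) : ℤ) : ℝ) = den (n + 1) ^ l.val * den n ^ k := by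
    rw [Fin.val_zero, approxVec_zero]
    push_cast
    rfl
  refine ⟨?_, fun i => ?_⟩
  · rw [e, abs_of_nonneg (by positivity)]
    refine le_trans ?_ hX
    exact mul_le_mul_of_nonneg_right (pow_le_pow_right₀ (one_le_cast_den _) hl) (by positivity)
  · rw [e]
    exact (abs_pow_mul_sub_approxVec_le hk (hl.trans hd) i.isLt).trans hη

/-! ### Suprema of exponents and location of `X` between scales -/

lemma coe_le_sSup_of_forall_lt {S : Set ℝ} {a : ℝ} (ha : 0 < a)
    (h : ∀ η, 0 < η → η < a → η ∈ S) :
    (a : EReal) ≤ sSup ((fun η : ℝ => (η : EReal)) '' S) := by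
  refine le_of_forall_lt fun c hc => ?_
  have hc' : max c 0 < (a : EReal) := max_lt hc (by exact_mod_cast ha)
  obtain ⟨η, h1, h2⟩ := EReal.lt_iff_exists_real_btwn.1 hc'
  have h3 : 0 < η := by exact_mod_cast (le_max_right c 0).trans_lt h1
  exact ((le_max_left c 0).trans_lt h1).trans_le
    (le_sSup ⟨η, h η h3 (by exact_mod_cast h2), rfl⟩)

lemma sSup_le_coe_of_forall_gt {S : Set ℝ} {a : ℝ} (h : ∀ η, a < η → η ∉ S) :
    sSup ((fun η : ℝ => (η : EReal)) '' S) ≤ (a : EReal) := by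
  refine sSup_le ?_
  rintro _ ⟨η, hη, rfl⟩
  exact EReal.coe_le_coe_iff.2 (not_lt.1 fun hlt => h η hlt hη)

lemma eventually_exists_le_and_lt {g : ℕ → ℝ} (hg : Tendsto g atTop atTop) {P : ℕ → Prop}
    (hP : ∀ᶠ n in atTop, P n) : ∀ᶠ X in atTop, ∃ n, P n ∧ g n ≤ X ∧ X < g (n + 1) := by
  obtain ⟨N, hN⟩ := eventually_atTop.1 hP
  filter_upwards [eventually_ge_atTop (g N)] with X hX
  have hex : ∃ m, X < g (N + m) :=
    ((tendsto_add_atTop_nat N).eventually (hg.eventually_gt_atTop X)).exists.imp fun m hm => by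
      rwa [add_comm]
  classical
  have hpos : Nat.find hex ≠ 0 := fun h0 => by
    have := Nat.find_spec hex
    rw [h0, add_zero] at this
    exact absurd this (not_lt.2 hX)
  obtain ⟨m, hm⟩ := Nat.exists_eq_succ_of_ne_zero hpos
  refine ⟨N + m, hN _ (Nat.le_add_right _ _), ?_, ?_⟩
  · exact not_lt.1 (Nat.find_min hex (m := m) (by omega))
  · have := Nat.find_spec hex
    rwa [hm] at this

lemma tendsto_den_rpow {r : ℝ} (hr : 0 < r) :
    Tendsto (fun n => (den n : ℝ) ^ r) atTop atTop :=
  (tendsto_rpow_atTop hr).comp tendsto_cast_den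

/-! ### Lower bounds for the exponents -/

lemma frequently_hasIndepSolutions {k d : ℕ} {η : ℝ} (hk : 1 ≤ k) (hd : d ≤ k)
    (hη : d * η < 1) :
    ∃ᶠ X in atTop, HasIndepSolutions k (d + 1) (powerVec k cantorLiouville) η X := by
  have hX : Tendsto (fun n => (den (n + 1) : ℝ) ^ d * den n ^ k) atTop atTop := by
    refine tendsto_atTop_mono (fun n => ?_) tendsto_cast_den
    calc (den n : ℝ) ≤ den n ^ k := le_self_pow₀ (one_le_cast_den n) (by omega)
      _ ≤ _ := le_mul_of_one_le_left (by positivity) (one_le_pow₀ (one_le_cast_den _))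
  refine hX.frequently (Eventually.frequently ?_)
  -- At `X = Q ^ d * q ^ k`, the bound `C * q ^ k / Q ≤ X ^ (-η)` rearranges to `C * q ^ (k + k * η)
  -- ≤ Q ^ (1 - d * η)`.
  filter_upwards [eventually_ge_atTop k, eventually_mul_den_rpow_lt_den_succ_rpow
    (3 ^ k + 3 * k) (k + k * η) (sub_pos.2 hη)] with n hn h
  refine hasIndepSolutions_of_le hd hn le_rfl ?_
  have hq := cast_den_pos n
  have hQ := cast_den_pos (n + 1)
  rw [Real.rpow_add hq, Real.rpow_sub hQ, Real.rpow_one, Real.rpow_natCast, lt_div_iff₀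
    (by positivity)] at h
  rw [← Real.rpow_natCast _ d, ← Real.rpow_natCast (den n) k, Real.mul_rpow (by positivity)
    (by positivity), ← Real.rpow_mul hQ.le, ← Real.rpow_mul hq.le, mul_neg, mul_neg,
    Real.rpow_neg hQ.le, Real.rpow_neg hq.le, Real.rpow_natCast, ← mul_div_assoc,
    div_le_iff₀ hQ, ← mul_inv, inv_mul_eq_div, le_div_iff₀ (by positivity)]
  linarith

lemma eventually_hasIndepSolutions_one {k : ℕ} {η : ℝ} (hk : 1 ≤ k) (h0 : 0 < η)
    (hη : k * η < 1) :
    ∀ᶠ X in atTop, HasIndepSolutions k 1 (powerVec k cantorLiouville) η X := by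
  have hkpos : (0 : ℝ) < k := by exact_mod_cast hk
  filter_upwards [eventually_exists_le_and_lt (tendsto_den_rpow hkpos)
    ((eventually_ge_atTop k).and (eventually_mul_den_rpow_lt_den_succ_rpow
    (3 ^ k + 3 * k) k (sub_pos.2 hη)))] with X ⟨n, ⟨hn, h⟩, hX1, hX2⟩
  have hq := cast_den_pos n
  have hQ := cast_den_pos (n + 1)
  have hX0 : 0 < X := (by positivity : (0 : ℝ) < (den n : ℝ) ^ (k : ℝ)).trans_le hX1
  refine hasIndepSolutions_of_le (d := 0) (Nat.zero_le k) hn ?_ ?_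
  · rwa [pow_zero, one_mul, ← Real.rpow_natCast]
  · have h1 : ((den (n + 1) : ℝ) ^ (k : ℝ)) ^ (-η) ≤ X ^ (-η) :=
      Real.rpow_le_rpow_of_nonpos hX0 hX2.le (by linarith)
    refine le_trans ?_ h1
    rw [← Real.rpow_mul hQ.le, mul_neg, Real.rpow_neg hQ.le, ← Real.rpow_natCast (den n) k,
      ← mul_div_assoc, div_le_iff₀ hQ]
    rw [Real.rpow_sub hQ, Real.rpow_one] at h
    exact h.le.trans_eq (div_eq_inv_mul _ _)

/-- The witnesses are `(1, round ζ_1, …, round ζ_k)` and the remaining unit vectors, whose errors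
are at most 1. -/
lemma hasIndepSolutions_zero {k j : ℕ} (hj : j ≤ k + 1) (ζ : Fin k → ℝ) {X : ℝ} (hX : 1 ≤ X) :
    HasIndepSolutions k j ζ 0 X := by
  let A : Matrix (Fin (k + 1)) (Fin (k + 1)) ℤ := Matrix.of fun m i =>
    if m = i then 1 else if m = 0 then Fin.cases 0 (fun i => round (ζ i)) i else 0
  have hA : A.det ≠ 0 := by
    rw [Matrix.det_of_isUpperTriangular]
    · simp [A]
    · intro m i hmi
      have h1 : m ≠ i := ne_of_gt hmi
      have h2 : m ≠ 0 := ne_of_gt (lt_of_le_of_lt (Fin.zero_le i) hmi)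
      simp [A, h1, h2]
  have hind := (Matrix.linearIndependent_rows_of_det_ne_zero hA).comp (Fin.castLE hj)
    (Fin.castLE_injective hj)
  refine ⟨_, hind, fun m => ?_⟩
  simp only [Function.comp_apply, neg_zero, Real.rpow_zero]
  generalize Fin.castLE hj m = m
  refine Fin.cases ?_ (fun m => ?_) m
  · refine ⟨by simpa [A] using hX, fun i => ?_⟩
    have h := abs_sub_round (ζ i)
    have h0 : (0 : Fin (k + 1)) ≠ i.succ := (Fin.succ_ne_zero i).symm
    simp only [A, Matrix.of_apply, if_true, if_neg h0, Fin.cases_succ, Int.cast_one, mul_one]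
    linarith
  · refine ⟨by simpa [A] using zero_le_one.trans hX, fun i => ?_⟩
    simp only [A, Matrix.of_apply, Fin.succ_ne_zero, if_false, Fin.succ_inj, Int.cast_zero,
      mul_zero, zero_sub, abs_neg]
    split_ifs <;> simp

/-! ### Upper bounds for the exponents -/

/-- At `X = Q ^ (1 / 2)` both `q * X ^ (-η)` and `X * q / Q` tend to 0, so all solutions lie on one
line. -/
lemma not_eventually_hasIndepSolutions {k j : ℕ} {η : ℝ} (hj : 2 ≤ j) (hη : 0 < η) :
    ¬ ∀ᶠ X in atTop, HasIndepSolutions k j (powerVec k cantorLiouville) η X := by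
  have hX : Tendsto (fun n => (den (n + 1) : ℝ) ^ (1 / 2 : ℝ)) atTop atTop :=
    (tendsto_den_rpow (by norm_num)).comp (tendsto_add_atTop_nat 1)
  intro hev
  obtain ⟨n, h, h1, h2⟩ := ((hX.eventually hev).and
    ((eventually_mul_den_rpow_lt_den_succ_rpow 4 1 (by positivity : 0 < η / 2)).and
    (eventually_mul_den_rpow_lt_den_succ_rpow 6 1 (by norm_num : (0 : ℝ) < 1 / 2)))).exists
  have hQ := cast_den_pos (n + 1)
  refine absurd (le_one_of_hasIndepSolutions (n := n) (by positivity) ?_ h) (by omega)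
  rw [Real.rpow_one] at h1 h2
  rw [← Real.rpow_mul hQ.le, mul_neg, Real.rpow_neg hQ.le, one_div_mul_eq_div, ← div_eq_mul_inv]
  set R : ℝ := (den (n + 1) : ℝ) ^ (1 / 2 : ℝ) with hR
  have hRR : (den (n + 1) : ℝ) = R * R := by
    rw [hR, ← Real.rpow_add hQ, add_halves, Real.rpow_one]
  have hR0 : 0 < R := by positivity
  have e1 : 2 * (den n : ℝ) / (den (n + 1) : ℝ) ^ (η / 2) < 1 / 2 := by
    rw [div_lt_iff₀ (by positivity)]
    linarith
  have e2 : R * (3 * (den n : ℝ) / (den (n + 1) : ℝ)) < 1 / 2 := by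
    rw [hRR, ← mul_div_assoc, mul_div_mul_left _ _ hR0.ne', div_lt_iff₀ hR0]
    linarith
  linarith

/-- The choice `X = q ^ k / 2` lies just below the first nonzero integer point of the line. -/
lemma not_eventually_hasIndepSolutions_one {k : ℕ} {η : ℝ} (hk : 1 ≤ k) (hη : 1 < k * η) :
    ¬ ∀ᶠ X in atTop, HasIndepSolutions k 1 (powerVec k cantorLiouville) η X := by
  have hX : Tendsto (fun n => (den n : ℝ) ^ k / 2) atTop atTop :=
    ((tendsto_pow_atTop (by omega)).comp tendsto_cast_den).atTop_div_const (by norm_num)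
  intro hev
  obtain ⟨n, h, h1, h2, hn⟩ := ((hX.eventually hev).and
    ((eventually_mul_den_rpow_lt_den_rpow (4 * 2 ^ η) hη).and
    ((eventually_mul_den_rpow_lt_den_succ_rpow 3 (k + 1) one_pos).and
    (eventually_ge_atTop 1)))).exists
  have hq := cast_den_pos n
  have hQ := cast_den_pos (n + 1)
  refine not_hasIndepSolutions_one (n := n) hn (by positivity) (half_lt_self (by positivity)) ?_ h
  rw [Real.rpow_one, Real.rpow_mul hq.le, Real.rpow_natCast] at h1
  rw [Real.rpow_one, Real.rpow_add hq, Real.rpow_one, Real.rpow_natCast] at h2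
  rw [Real.rpow_neg (by positivity), Real.div_rpow (by positivity) (by norm_num), inv_div,
    ← mul_div_assoc]
  have e1 : 2 * (den n : ℝ) * 2 ^ η / ((den n : ℝ) ^ k) ^ η < 1 / 2 := by
    rw [div_lt_iff₀ (by positivity)]
    linarith
  have e2 : (den n : ℝ) ^ k / 2 * (3 * den n / den (n + 1)) < 1 / 2 := by
    rw [← mul_div_assoc, div_lt_iff₀ hQ]
    linarith
  linarith

/-- For `1 / η < r < d` the intervals `[q ^ r, Q ^ r)` cover all large `X`. Up to `Q ^ (1 / 2)` the
line argument applies, as `r * η > 1` makes `q * X ^ (-η)` small; beyond it `X ^ (-η)` beats every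
power of `q`, and `r < d` makes `X * (3 * q / Q) ^ d` small. -/
lemma not_frequently_hasIndepSolutions {k d : ℕ} {η : ℝ} (hd : 1 ≤ d) (hη : 1 < d * η) :
    ¬ ∃ᶠ X in atTop, HasIndepSolutions k (d + 1) (powerVec k cantorLiouville) η X := by
  have hdpos : (0 : ℝ) < d := by exact_mod_cast hd
  have hη0 : 0 < η := pos_of_mul_pos_right (zero_lt_one.trans hη) hdpos.le
  obtain ⟨r, hr1, hr2⟩ := exists_between ((div_lt_iff₀ hη0).2 hη)
  have hr0 : 0 < r := (by positivity : 0 < 1 / η).trans hr1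
  have hrη : 1 < r * η := (div_lt_iff₀ hη0).1 hr1
  rw [not_frequently]
  filter_upwards [eventually_exists_le_and_lt (tendsto_den_rpow hr0)
    ((eventually_mul_den_rpow_lt_den_rpow 4 hrη).and
    ((eventually_mul_den_rpow_lt_den_succ_rpow 6 1 (by norm_num : (0 : ℝ) < 1 / 2)).and
    ((eventually_mul_den_rpow_lt_den_succ_rpow (2 * 2 ^ k) k (by positivity : 0 < 1 / 2 * η)).and
    ((eventually_mul_den_rpow_lt_den_succ_rpow (2 * 3 ^ k) k (sub_pos.2 hr2)).and
    (eventually_mul_den_rpow_lt_den_succ_rpow 3 1 one_pos))))),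
    eventually_gt_atTop 0] with X ⟨n, ⟨h1, h2, h3, h4, h5⟩, hX1, hX2⟩ hX0 hs
  have hq := cast_den_pos n
  have hq1 := one_le_cast_den n
  have hQ := cast_den_pos (n + 1)
  rw [Real.rpow_one] at h1 h2 h5
  rw [Real.rpow_one] at h5
  rw [Real.rpow_natCast] at h3 h4
  rcases le_or_gt X ((den (n + 1) : ℝ) ^ (1 / 2 : ℝ)) with hX | hX
  · refine absurd (le_one_of_hasIndepSolutions (n := n) hX0.le ?_ hs) (by omega)
    set R : ℝ := (den (n + 1) : ℝ) ^ (1 / 2 : ℝ) with hR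
    have hRR : (den (n + 1) : ℝ) = R * R := by
      rw [hR, ← Real.rpow_add hQ, add_halves, Real.rpow_one]
    have hR0 : 0 < R := by positivity
    have hXη : (den n : ℝ) ^ (r * η) ≤ X ^ η := by
      rw [Real.rpow_mul hq.le]
      exact Real.rpow_le_rpow (by positivity) hX1 hη0.le
    have e1 : 2 * (den n : ℝ) * X ^ (-η) < 1 / 2 := by
      rw [Real.rpow_neg hX0.le, ← div_eq_mul_inv, div_lt_iff₀ (by positivity)]
      linarith
    have e2 : X * (3 * (den n : ℝ) / den (n + 1)) < 1 / 2 := by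
      refine (mul_le_mul_of_nonneg_right hX (by positivity)).trans_lt ?_
      rw [hRR, ← mul_div_assoc, mul_div_mul_left _ _ hR0.ne', div_lt_iff₀ hR0]
      linarith
    linarith
  · refine absurd (le_of_hasIndepSolutions (n := n) (d := d) hX0.le (fun s hds hsk => ?_) hs)
      (by omega)
    have hXη : (den (n + 1) : ℝ) ^ (1 / 2 * η) ≤ X ^ η := by
      rw [Real.rpow_mul hQ.le]
      exact Real.rpow_le_rpow (by positivity) hX.le hη0.le
    have e1 : (2 * (den n : ℝ)) ^ k * X ^ (-η) < 1 / 2 := by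
      rw [Real.rpow_neg hX0.le, ← div_eq_mul_inv, div_lt_iff₀ (by positivity), mul_pow]
      linarith
    have e2 : X * (3 * (den n : ℝ) / den (n + 1)) ^ s < 1 / 2 := by
      have h6 : (3 * (den n : ℝ) / den (n + 1)) ^ s ≤ (3 * (den n : ℝ) / den (n + 1)) ^ d :=
        pow_le_pow_of_le_one (by positivity) ((div_le_one hQ).2 h5.le) hds
      have h7 : (3 * (den n : ℝ)) ^ d ≤ (3 * den n) ^ k :=
        pow_le_pow_right₀ (by linarith) (hds.trans hsk)
      rw [Real.rpow_sub hQ, Real.rpow_natCast, lt_div_iff₀ (by positivity)] at h4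
      calc X * (3 * (den n : ℝ) / den (n + 1)) ^ s
          ≤ (den (n + 1) : ℝ) ^ r * (3 * (den n : ℝ) / den (n + 1)) ^ d :=
            mul_le_mul hX2.le h6 (by positivity) (by positivity)
        _ ≤ (den (n + 1) : ℝ) ^ r * ((3 * den n) ^ k / den (n + 1) ^ d) := by
            rw [div_pow]
            gcongr
        _ < 1 / 2 := by
            rw [← mul_div_assoc, div_lt_iff₀ (by positivity), mul_pow]
            linarith
    linarith

end CantorLiouville

open CantorLiouville in
theorem mainTheorem7 :
    Summable (fun l : ℕ => 1 / (3 : ℝ) ^ (l + 1)!) ∧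
    cantorLiouville ∈ cantorSet ∧
    ∀ k : ℕ, 1 ≤ k →
      powApproxConst k 1 cantorLiouville = ⊤ ∧
      (∀ j : ℕ, 2 ≤ j → j ≤ k + 1 →
        powApproxConst k j cantorLiouville = ((1 / ((j : ℝ) - 1) : ℝ) : EReal)) ∧
      powUnifApproxConst k 1 cantorLiouville = ((1 / (k : ℝ) : ℝ) : EReal) ∧
      (∀ j : ℕ, 2 ≤ j → j ≤ k + 1 →
        powUnifApproxConst k j cantorLiouville = 0) := by
  refine ⟨summable_one_div_three_pow, cantorLiouville_mem_cantorSet, fun k hk =>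
    ⟨?_, fun j hj hjk => ?_, ?_, fun j hj hjk => ?_⟩⟩
  · refine (EReal.eq_top_iff_forall_lt _).2 fun y => ?_
    refine (EReal.coe_lt_coe_iff.2 (lt_add_one y)).trans_le (le_sSup ⟨y + 1, ?_, rfl⟩)
    -- With `d = 0` the condition `d * η < 1` holds for every real `η`.
    exact frequently_hasIndepSolutions hk (Nat.zero_le k) (by simp)
  · obtain ⟨d, rfl⟩ : ∃ d, j = d + 1 := ⟨j - 1, by omega⟩
    have hd : (0 : ℝ) < d := by exact_mod_cast (by omega : 0 < d)
    have e : 1 / (((d + 1 : ℕ) : ℝ) - 1) = 1 / (d : ℝ) := by push_cast; ring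
    rw [e]
    refine le_antisymm (sSup_le_coe_of_forall_gt fun η hη => ?_)
      (coe_le_sSup_of_forall_lt (by positivity) fun η _ hη => ?_)
    · exact not_frequently_hasIndepSolutions (by omega) ((div_lt_iff₀' hd).1 hη)
    · exact frequently_hasIndepSolutions hk (by omega) ((lt_div_iff₀' hd).1 hη)
  · have hk0 : (0 : ℝ) < k := by exact_mod_cast hk
    refine le_antisymm (sSup_le_coe_of_forall_gt fun η hη => ?_)
      (coe_le_sSup_of_forall_lt (by positivity) fun η h0 hη => ?_)
    · exact not_eventually_hasIndepSolutions_one hk ((div_lt_iff₀' hk0).1 hη)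
    · exact eventually_hasIndepSolutions_one hk h0 ((lt_div_iff₀' hk0).1 hη)
  · refine le_antisymm (sSup_le_coe_of_forall_gt (a := 0) fun η hη => ?_) (le_sSup ⟨0, ?_, rfl⟩)
    · exact not_eventually_hasIndepSolutions hj hη
    · filter_upwards [eventually_ge_atTop 1] with X hX
      exact hasIndepSolutions_zero hjk _ hX
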